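/- Let $\rho$ be a density matrix on $L^2(\mathbb R)$, i.e. a self-adjoint, positive, trace-class operator with $\operatorname{tr}\rho=1$, and let $K_\rho\in L^2(\mathbb R^2)$ be its Hilbert--Schmidt kernel, $(\rho\psi)(x)=\int_{\mathbb R}K_\rho(x,y)\psi(y)\,dy$. Then there is a unique continuous function $W\rho:\mathbb R^2\to\mathbb R$, the Wigner function of $\rho$, such that for almost every $(x,\xi)\in\mathbb R^2$ $$W\rho(x,\xi)=\frac1{2\pi}\int_{\mathbb R}e^{-i\xi y}K_\rho\Bigl(x+\frac y2,x-\frac y2\Bigr)\,dy,$$ the integral being absolutely convergent. If the nodal set $\mathcal N(\rho)=\{z\in\mathbb R^2: W\rho(z)=0\}$ is bounded (the empty set counts as bounded), then the negative set $\Omega_-(\rho)=\{z\in\mathbb R^2: W\rho(z)\le 0\}$ is bounded and closed, hence compact. -/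

import Mathlib

open MeasureTheory

/-- The Hilbert space `L²(ℝ)` of complex-valued square-integrable functions (modulo a.e. equality). -/
abbrev L2R : Type := Lp ℂ 2 (volume : Measure ℝ)

section Operators

variable {H : Type} [NormedAddCommGroup H] [InnerProductSpace ℂ H] [CompleteSpace H]

/-- `T` is trace class: `∑ᵢ ⟨eᵢ, |T| eᵢ⟩ < ∞` for orthonormal bases `e`, where `|T| = √(T* T)`. -/
def IsTraceClass (T : H →L[ℂ] H) : Prop :=
  ∀ (ι : Type) (e : HilbertBasis ι ℂ H),
    Summable fun i => (inner ℂ (e i) ((CFC.abs T) (e i))).re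

/-- The trace of `T` is `t`: `∑ᵢ ⟨eᵢ, T eᵢ⟩ = t` for orthonormal bases `e`. -/
def HasTrace (T : H →L[ℂ] H) (t : ℂ) : Prop :=
  ∀ (ι : Type) (e : HilbertBasis ι ℂ H), HasSum (fun i => inner ℂ (e i) (T (e i))) t

/-- Density matrices: positive (in particular self-adjoint) trace-class operators of trace one. -/
structure IsDensityMatrix (ρ : H →L[ℂ] H) : Prop where
  isSelfAdjoint : IsSelfAdjoint ρ
  isPositive : ρ.IsPositive
  isTraceClass : IsTraceClass ρ
  hasTrace_one : HasTrace ρ 1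

end Operators

/-- `K ∈ L²(ℝ²)` is a Hilbert–Schmidt kernel of the operator `ρ` on `L²(ℝ)`:
`(ρ ψ)(x) = ∫ K(x, y) ψ(y) dy` for almost every `x`, for every `ψ ∈ L²(ℝ)`. -/
structure IsHilbertSchmidtKernel (ρ : L2R →L[ℂ] L2R) (K : ℝ × ℝ → ℂ) : Prop where
  memLp : MemLp K 2 (volume : Measure (ℝ × ℝ))
  apply_eq : ∀ ψ : L2R, ∀ᵐ x : ℝ, (ρ ψ : ℝ → ℂ) x = ∫ y : ℝ, K (x, y) * (ψ : ℝ → ℂ) y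

/-- The integrand `y ↦ e^{-iξy} K(x + y/2, x - y/2)` at the phase-space point `z = (x, ξ)`. -/
noncomputable def wignerIntegrand (K : ℝ × ℝ → ℂ) (z : ℝ × ℝ) (y : ℝ) : ℂ :=
  Complex.exp (-(Complex.I * (z.2 : ℂ) * (y : ℂ))) * K (z.1 + y / 2, z.1 - y / 2)

/-- `W` is the Wigner function of `ρ`: the continuous function on phase space given by
`W(x, ξ) = (1 / 2π) ∫ e^{-iξy} K(x + y/2, x - y/2) dy`, where `K` is the kernel of `ρ`.
As `K` is only defined up to null sets of `ℝ²`, the formula is required for almost every `(x, ξ)`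
(with an absolutely convergent integral), and continuity fixes the value at every point. -/
structure IsWignerFunction (ρ : L2R →L[ℂ] L2R) (W : ℝ × ℝ → ℝ) : Prop where
  continuous : Continuous W
  exists_kernel : ∃ K : ℝ × ℝ → ℂ, IsHilbertSchmidtKernel ρ K ∧
    ∀ᵐ z : ℝ × ℝ, Integrable (wignerIntegrand K z) ∧
      (W z : ℂ) = 1 / (2 * (Real.pi : ℂ)) * ∫ y : ℝ, wignerIntegrand K z y

/-- The nodal set `{z | W z = 0}`. -/
def nodalSet (W : ℝ × ℝ → ℝ) : Set (ℝ × ℝ) := {z | W z = 0}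

/-- The negative set `{z | W z ≤ 0}`. -/
def negativeSet (W : ℝ × ℝ → ℝ) : Set (ℝ × ℝ) := {z | W z ≤ 0}

/-!
Factoring `ρ = S * S` with `S = √ρ` and expanding along an orthonormal basis `e` gives
`ρ ψ = ∑ᵢ ⟨fᵢ, ψ⟩ fᵢ` with `fᵢ = S eᵢ` and `∑ᵢ ‖fᵢ‖² = tr ρ < ∞`
(`IsDensityMatrix.exists_hasSum_rankOne`); this replaces the spectral decomposition of `ρ`. Then
`K(x, y) = ∑ᵢ fᵢ(x) conj fᵢ(y)` is a Hilbert–Schmidt kernel of `ρ`, and its Wigner transform is the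
sum of the Wigner functions of the `fᵢ`. Each of these is continuous, since translations act
continuously on `L²(ℝ)`, and bounded by `‖fᵢ‖²`, so the sum converges uniformly to a continuous
function (`isWignerFunction_mixedWigner`). Uniqueness holds because an operator determines its
kernel almost everywhere and `(x, y) ↦ (x + y/2, x - y/2)` preserves Lebesgue measure.

Let the nodal set be bounded. Outside a large ball, `W` has no zeros on a connected set, so it has
constant sign there, and it suffices to exclude the negative sign. Pairing `ρ` with the Gaussian
`φₐ(x) = exp(-x²/2 + a x)` shows that
`∫ W(x, ξ) exp(-x² - ξ² + 2 a x) dx dξ` is a positive multiple of `⟨φₐ, ρ φₐ⟩`, hence nonnegative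
for every real `a` (`integral_mixedWigner_mul_gaussianWeight_nonneg`). If `W` were negative for
`‖(x, ξ)‖ > R`, then after multiplication by `exp(-2 a R)` the possibly positive contribution of the
ball would stay bounded as `a → ∞`, whereas the negative contribution of
`[R + 1, R + 2] × [0, 1]` would grow like `exp(2 a)`: a contradiction
(`not_forall_neg_of_gaussianWeight`).
-/

open scoped ComplexConjugate

/-! ### Rank-one expansion of a density matrix -/

section
variable {H : Type} [NormedAddCommGroup H] [InnerProductSpace ℂ H] [CompleteSpace H]

/-- A density matrix is a strongly convergent sum of rank-one operators `ψ ↦ ⟨fᵢ, ψ⟩ fᵢ` with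
`∑ᵢ ‖fᵢ‖² < ∞`: take `fᵢ = √ρ eᵢ`. The `fᵢ` need not be orthogonal. -/
theorem IsDensityMatrix.exists_hasSum_rankOne {ρ : H →L[ℂ] H} (hρ : IsDensityMatrix ρ) :
    ∃ (ι : Type) (_ : Countable ι) (f : ι → H), Summable (fun i => ‖f i‖ ^ 2) ∧
      ∀ ψ, HasSum (fun i => inner ℂ (f i) ψ • f i) (ρ ψ) := by
  obtain ⟨w, e, -⟩ := exists_hilbertBasis ℂ H
  have h0 : 0 ≤ ρ := (ContinuousLinearMap.nonneg_iff_isPositive ρ).2 hρ.isPositive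
  set S : H →L[ℂ] H := CFC.sqrt ρ with hS
  have hSS : S * S = ρ := CFC.sqrt_mul_sqrt_self ρ h0
  have hSsa : IsSelfAdjoint S := IsSelfAdjoint.of_nonneg (CFC.sqrt_nonneg ρ)
  have hsym : ∀ x y, inner ℂ (S x) y = inner ℂ x (S y) := fun x y =>
    (ContinuousLinearMap.isSelfAdjoint_iff_isSymmetric.1 hSsa) x y
  have hsum : Summable (fun i => ‖S (e i)‖ ^ 2) := by
    have h1 := (hρ.hasTrace_one w e).summable
    have h2 := Complex.reCLM.summable h1
    refine h2.congr fun i => ?_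
    have : ρ (e i) = S (S (e i)) := by rw [← hSS]; rfl
    rw [this, ← hsym, inner_self_eq_norm_sq_to_K]
    simp [← Complex.ofReal_pow]
  have happ : ∀ ψ, HasSum (fun i => inner ℂ (S (e i)) ψ • S (e i)) (ρ ψ) := by
    intro ψ
    have h1 := (e.hasSum_repr (S ψ)).mapL S
    have : ρ ψ = S (S ψ) := by rw [← hSS]; rfl
    rw [this]
    refine h1.congr_fun fun i => ?_
    simp [e.repr_apply_apply, hsym]
  -- A summable family has countable support; dropping the zero terms makes the index countable.
  refine ⟨Function.support (fun i => ‖S (e i)‖ ^ 2), hsum.countable_support.to_subtype,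
    fun i => S (e i), hsum.subtype _, fun ψ => ?_⟩
  refine (hasSum_subtype_iff_of_support_subset ?_).2 (happ ψ)
  intro i hi hi0
  apply hi
  have : S (e i) = 0 := by simpa using hi0
  simp [this]
end

/-! ### Series of integrable functions -/

section
variable {α ι E : Type*} [MeasurableSpace α] {μ : Measure α} [Countable ι]
  [NormedAddCommGroup E]

theorem lintegral_tsum_enorm_lt_top {F : ι → α → E} (hF : ∀ i, Integrable (F i) μ)
    (hs : Summable fun i => ∫ a, ‖F i a‖ ∂μ) : ∫⁻ a, ∑' i, ‖F i a‖ₑ ∂μ < ⊤ := by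
  rw [lintegral_tsum fun i => (hF i).1.enorm]
  have h : ∀ i, ∫⁻ a, ‖F i a‖ₑ ∂μ = ENNReal.ofReal (∫ a, ‖F i a‖ ∂μ) := fun i =>
    (ofReal_integral_norm_eq_lintegral_enorm (hF i)).symm
  simp_rw [h]
  rw [← ENNReal.ofReal_tsum_of_nonneg (fun i => integral_nonneg fun a => norm_nonneg _) hs]
  exact ENNReal.ofReal_lt_top

theorem ae_summable_norm {F : ι → α → E} (hF : ∀ i, Integrable (F i) μ)
    (hs : Summable fun i => ∫ a, ‖F i a‖ ∂μ) : ∀ᵐ a ∂μ, Summable fun i => ‖F i a‖ := by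
  have h := ae_lt_top' (AEMeasurable.tsum fun i => (hF i).1.enorm)
    (lintegral_tsum_enorm_lt_top hF hs).ne
  filter_upwards [h] with a ha
  have := ENNReal.summable_toReal ha.ne
  simpa using this

theorem integrable_tsum_of_summable_integral_norm [CompleteSpace E]
    [SecondCountableTopology E] {F : ι → α → E} (hF : ∀ i, Integrable (F i) μ)
    (hs : Summable fun i => ∫ a, ‖F i a‖ ∂μ) : Integrable (fun a => ∑' i, F i a) μ := by
  borelize E
  exact ⟨(AEMeasurable.tsum fun i => (hF i).1.aemeasurable).aestronglyMeasurable,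
    (lintegral_mono fun a => enorm_tsum_le_tsum_enorm).trans_lt
      (lintegral_tsum_enorm_lt_top hF hs)⟩
end

/-! ### The Wigner function of a pure state -/

/-- The integral kernel `g ⊗ conj g` of the rank-one operator `ψ ↦ ⟨g, ψ⟩ g`. -/
def rankOneKernel (g : ℝ → ℂ) (p : ℝ × ℝ) : ℂ := g p.1 * conj (g p.2)

theorem norm_wignerIntegrand (K : ℝ × ℝ → ℂ) (z : ℝ × ℝ) (y : ℝ) :
    ‖wignerIntegrand K z y‖ = ‖K (z.1 + y / 2, z.1 - y / 2)‖ := by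
  rw [wignerIntegrand, norm_mul]
  have : -(Complex.I * (z.2 : ℂ) * (y : ℂ)) = ((-(z.2 * y) : ℝ) : ℂ) * Complex.I := by
    push_cast; ring
  rw [this, Complex.norm_exp_ofReal_mul_I, one_mul]

/-- The map is a composition of two shears, a reflection and two coordinate swaps. -/
theorem measurePreserving_wignerMap :
    MeasurePreserving (fun p : ℝ × ℝ => (p.1 + p.2 / 2, p.1 - p.2 / 2)) volume volume := by
  have h1 : MeasurePreserving (fun p : ℝ × ℝ => (p.1, p.2 + p.1 / 2)) volume volume :=
    (MeasurePreserving.id volume).skew_product (g := fun y x => x + y / 2)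
      (by fun_prop) (ae_of_all _ fun y => (measurePreserving_add_right volume (y / 2)).map_eq)
  have h2 : MeasurePreserving (fun p : ℝ × ℝ => (p.1, p.1 - p.2)) volume volume :=
    (MeasurePreserving.id volume).skew_product (g := fun u y => u - y)
      (by fun_prop) (ae_of_all _ fun u => (Measure.measurePreserving_sub_left volume u).map_eq)
  have h3 : MeasurePreserving (Prod.swap : ℝ × ℝ → ℝ × ℝ) volume volume :=
    Measure.measurePreserving_swap
  convert h2.comp (h3.comp (h1.comp h3)) using 1
  ext p <;> simp
  ring

section
variable {g : ℝ → ℂ}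

theorem integrable_normSq (hg : MemLp g 2) : Integrable (fun y => ‖g y‖ ^ 2) :=
  hg.integrable_norm_pow (by norm_num)

theorem integrable_normSq_add (hg : MemLp g 2) (x : ℝ) :
    Integrable (fun y => ‖g (x + y / 2)‖ ^ 2) :=
  ((integrable_normSq hg).comp_add_left x).comp_div two_ne_zero

theorem integrable_normSq_sub (hg : MemLp g 2) (x : ℝ) :
    Integrable (fun y => ‖g (x - y / 2)‖ ^ 2) :=
  ((integrable_normSq hg).comp_sub_left x).comp_div two_ne_zero

theorem integral_normSq_add (g : ℝ → ℂ) (x : ℝ) :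
    ∫ y, ‖g (x + y / 2)‖ ^ 2 = 2 * ∫ y, ‖g y‖ ^ 2 := by
  rw [Measure.integral_comp_div (fun y => ‖g (x + y)‖ ^ 2) 2,
    integral_add_left_eq_self (fun y => ‖g y‖ ^ 2) x]
  simp

theorem integral_normSq_sub (g : ℝ → ℂ) (x : ℝ) :
    ∫ y, ‖g (x - y / 2)‖ ^ 2 = 2 * ∫ y, ‖g y‖ ^ 2 := by
  rw [Measure.integral_comp_div (fun y => ‖g (x - y)‖ ^ 2) 2,
    integral_sub_left_eq_self (fun y => ‖g y‖ ^ 2) volume x]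
  simp

theorem norm_rankOneKernel_le (g : ℝ → ℂ) (u v : ℝ) :
    ‖rankOneKernel g (u, v)‖ ≤ (‖g u‖ ^ 2 + ‖g v‖ ^ 2) / 2 := by
  rw [rankOneKernel, norm_mul, RCLike.norm_conj]
  nlinarith [sq_nonneg (‖g u‖ - ‖g v‖)]

theorem stronglyMeasurable_rankOneKernel (hgm : StronglyMeasurable g) :
    StronglyMeasurable (rankOneKernel g) := by
  refine (hgm.comp_measurable measurable_fst).mul ?_
  exact Complex.continuous_conj.comp_stronglyMeasurable (hgm.comp_measurable measurable_snd)

theorem stronglyMeasurable_wignerIntegrand {K : ℝ × ℝ → ℂ} (hK : StronglyMeasurable K) (z : ℝ × ℝ) :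
    StronglyMeasurable (wignerIntegrand K z) :=
  (by fun_prop : Continuous fun y : ℝ =>
      Complex.exp (-(Complex.I * (z.2 : ℂ) * (y : ℂ)))).stronglyMeasurable.mul
    (hK.comp_measurable (by fun_prop))

theorem integrable_wignerIntegrand_rankOne (hgm : StronglyMeasurable g) (hg : MemLp g 2)
    (z : ℝ × ℝ) : Integrable (wignerIntegrand (rankOneKernel g) z) := by
  refine (((integrable_normSq_add hg z.1).add (integrable_normSq_sub hg z.1)).div_const 2).mono'
    (stronglyMeasurable_wignerIntegrand
      (stronglyMeasurable_rankOneKernel hgm) z).aestronglyMeasurable (ae_of_all _ fun y => ?_)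
  rw [norm_wignerIntegrand]
  exact norm_rankOneKernel_le g _ _

theorem integral_norm_wignerIntegrand_rankOne_le (hgm : StronglyMeasurable g) (hg : MemLp g 2)
    (z : ℝ × ℝ) : ∫ y, ‖wignerIntegrand (rankOneKernel g) z y‖ ≤ 2 * ∫ y, ‖g y‖ ^ 2 := by
  have h := integral_mono (integrable_wignerIntegrand_rankOne hgm hg z).norm
    (((integrable_normSq_add hg z.1).add (integrable_normSq_sub hg z.1)).div_const 2) fun y => by
      show _ ≤ (‖g (z.1 + y / 2)‖ ^ 2 + ‖g (z.1 - y / 2)‖ ^ 2) / 2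
      rw [norm_wignerIntegrand]
      exact norm_rankOneKernel_le g _ _
  refine h.trans_eq ?_
  rw [integral_div]
  simp only [Pi.add_apply]
  rw [integral_add (integrable_normSq_add hg z.1) (integrable_normSq_sub hg z.1),
    integral_normSq_add, integral_normSq_sub]
  ring

/-- The Wigner function of the (not necessarily normalized) pure state `g`. It is defined as a real
part; `ofReal_pureWigner` shows that the imaginary part vanishes. -/
noncomputable def pureWigner (g : ℝ → ℂ) (z : ℝ × ℝ) : ℝ :=
  (1 / (2 * (Real.pi : ℂ)) * ∫ y : ℝ, wignerIntegrand (rankOneKernel g) z y).re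

theorem ofReal_pureWigner (g : ℝ → ℂ) (z : ℝ × ℝ) : (pureWigner g z : ℂ) =
    1 / (2 * (Real.pi : ℂ)) * ∫ y : ℝ, wignerIntegrand (rankOneKernel g) z y := by
  refine Complex.conj_eq_iff_re.1 ?_
  have h : conj (∫ y : ℝ, wignerIntegrand (rankOneKernel g) z y) =
      ∫ y : ℝ, wignerIntegrand (rankOneKernel g) z y := by
    -- Conjugation amounts to the substitution `y ↦ -y`.
    rw [← integral_conj, ← integral_neg_eq_self]
    refine integral_congr_ae (ae_of_all _ fun y => ?_)
    simp only [wignerIntegrand, rankOneKernel, map_mul, ← Complex.exp_conj, map_neg,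
      Complex.conj_I, Complex.conj_ofReal, Complex.conj_conj]
    rw [neg_div, sub_neg_eq_add, ← sub_eq_add_neg, mul_comm (g _)]
    congr 2
    push_cast
    ring
  have h2 : conj (2 : ℂ) = 2 := Complex.conj_ofNat 2
  simp [h, h2]

/-- The constant is not sharp: the proof estimates `1 / (2 π)` by `1 / 2`. -/
theorem abs_pureWigner_le (hgm : StronglyMeasurable g) (hg : MemLp g 2) (z : ℝ × ℝ) :
    |pureWigner g z| ≤ ∫ y, ‖g y‖ ^ 2 := by
  rw [← Real.norm_eq_abs, ← Complex.norm_real, ofReal_pureWigner, norm_mul]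
  have h1 := (norm_integral_le_integral_norm _).trans
    (integral_norm_wignerIntegrand_rankOne_le hgm hg z)
  have h2 : ‖1 / (2 * (Real.pi : ℂ))‖ ≤ 1 / 2 := by
    rw [norm_div, norm_mul, Complex.norm_real, Real.norm_of_nonneg Real.pi_pos.le]
    simp only [norm_one, Complex.norm_ofNat]
    have := Real.pi_gt_three
    gcongr
    linarith
  have h3 : 0 ≤ ∫ y, ‖g y‖ ^ 2 := integral_nonneg fun y => by positivity
  calc _ ≤ 1 / 2 * (2 * ∫ y, ‖g y‖ ^ 2) := mul_le_mul h2 h1 (norm_nonneg _) (by norm_num)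
    _ = _ := by ring

/-- The substitution `y = 2 (x - s)` turns the Wigner integral into a phase times the pairing of `g`
with a modulation by `ξ` of the translate `s ↦ g (2 x - s)`. The translate depends continuously on
`x` in `L²`, and the pairing is Lipschitz in the translate uniformly in `ξ`. -/
theorem continuous_pureWigner (hg : MemLp g 2) : Continuous (pureWigner g) := by
  have : Fact ((2 : ENNReal) ≠ ⊤) := ⟨by norm_num⟩
  have hneg : MemLp (fun s => g (-s)) 2 :=
    hg.comp_measurePreserving (Measure.measurePreserving_neg volume)
  let u : L2R := hneg.toLp
  let τ : ℝ → L2R := fun c => DomAddAct.mk (-c) +ᵥ u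
  have hτ : Continuous τ := by
    have : Continuous fun c : ℝ => (DomAddAct.mk (-c) : ℝᵈᵃᵃ) :=
      DomAddAct.mkHomeomorph.continuous.comp continuous_neg
    exact this.vadd continuous_const
  have hτae : ∀ c, (τ c : ℝ → ℂ) =ᵐ[volume] fun s => g (c - s) := by
    intro c
    have : τ c = MemLp.toLp _ _ := DomAddAct.mk_vadd_toLp (-c) hneg
    rw [this]
    refine (MemLp.coeFn_toLp _).trans (ae_of_all _ fun s => ?_)
    simp [sub_eq_add_neg, add_comm]
  let B : L2R × ℝ → ℂ := fun q => ∫ s : ℝ,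
    Complex.exp (2 * Complex.I * q.2 * s) * conj (g s) * (q.1 : ℝ → ℂ) s
  have hexp : ∀ ξ s : ℝ, ‖Complex.exp (2 * Complex.I * ξ * s)‖ = 1 := fun ξ s => by
    have : 2 * Complex.I * ξ * s = ((2 * ξ * s : ℝ) : ℂ) * Complex.I := by push_cast; ring
    rw [this, Complex.norm_exp_ofReal_mul_I]
  have hconj : MemLp (fun s => conj (g s)) 2 := hg.star
  have hint : ∀ v : L2R, Integrable fun s => conj (g s) * (v : ℝ → ℂ) s := fun v =>
    hconj.integrable_mul (Lp.memLp v)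
  have hintexp : ∀ (v : L2R) (ξ : ℝ), Integrable fun s : ℝ =>
      Complex.exp (2 * Complex.I * ξ * s) * conj (g s) * (v : ℝ → ℂ) s := fun v ξ => by
    refine (hint v).norm.mono' ?_ (ae_of_all _ fun s => ?_)
    · simp_rw [mul_assoc]
      exact (by fun_prop : Continuous fun s : ℝ =>
        Complex.exp (2 * (Complex.I * (ξ * s)))).aestronglyMeasurable.mul (hint v).1
    · rw [mul_assoc, norm_mul, hexp, one_mul]
  have hB : Continuous B := by
    refine continuous_prod_of_continuous_lipschitzWith B ‖hg.toLp‖₊ (fun v => ?_) (fun ξ => ?_)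
    · refine continuous_of_dominated (fun ξ => (hintexp v ξ).1)
        (fun ξ => ae_of_all _ fun s => ?_) (hint v).norm (ae_of_all _ fun s => by
        dsimp only; fun_prop)
      rw [mul_assoc, norm_mul, hexp, one_mul]
    · refine LipschitzWith.of_dist_le_mul fun v w => ?_
      let m : ℝ → ℂ := fun s => Complex.exp (-(2 * Complex.I * ξ * s)) * g s
      have hmn : ∀ s, ‖m s‖ = ‖g s‖ := fun s => by
        have := hexp (-ξ) s
        simp only [m, norm_mul]
        rw [show -(2 * Complex.I * (ξ : ℂ) * s) = 2 * Complex.I * ((-ξ : ℝ) : ℂ) * s by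
          push_cast; ring, this, one_mul]
      have hm : MemLp m 2 := hg.congr_norm
        ((by fun_prop : Continuous fun s : ℝ =>
          Complex.exp (-(2 * Complex.I * ξ * s))).aestronglyMeasurable.mul hg.1)
        (ae_of_all _ fun s => (hmn s).symm)
      have hBm : ∀ v : L2R, B (v, ξ) = inner ℂ hm.toLp v := fun v => by
        rw [L2.inner_def]
        refine integral_congr_ae ?_
        filter_upwards [hm.coeFn_toLp] with s hs
        rw [hs, RCLike.inner_apply]
        simp only [m, map_mul, ← Complex.exp_conj, map_neg, Complex.conj_I, Complex.conj_ofReal,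
          Complex.conj_ofNat]
        rw [mul_comm ((v : ℝ → ℂ) s)]
        congr 3
        ring
      have hnorm : ‖hm.toLp‖ = ‖hg.toLp‖ := by
        rw [Lp.norm_toLp, Lp.norm_toLp, eLpNorm_congr_norm_ae (ae_of_all _ hmn)]
      rw [dist_eq_norm, dist_eq_norm, hBm, hBm, ← inner_sub_right]
      exact (norm_inner_le_norm _ _).trans_eq (by rw [hnorm]; rfl)
  have hform : ∀ z : ℝ × ℝ, (pureWigner g z : ℂ) =
      1 / (2 * (Real.pi : ℂ)) * (2 * (Complex.exp (-(2 * Complex.I * z.1 * z.2)) *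
        B (τ (2 * z.1), z.2))) := by
    intro z
    rw [ofReal_pureWigner]
    congr 1
    have h1 : ∫ y, wignerIntegrand (rankOneKernel g) z y =
        2 * ∫ s, wignerIntegrand (rankOneKernel g) z (2 * (z.1 - s)) := by
      rw [integral_sub_left_eq_self (fun s => wignerIntegrand (rankOneKernel g) z (2 * s))
        volume z.1, Measure.integral_comp_mul_left (wignerIntegrand (rankOneKernel g) z)]
      simp
    rw [h1]
    congr 1
    refine Eq.trans ?_ (integral_const_mul _ _)
    refine integral_congr_ae ?_
    filter_upwards [hτae (2 * z.1)] with s hs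
    simp only [hs, wignerIntegrand, rankOneKernel]
    rw [show z.1 + 2 * (z.1 - s) / 2 = 2 * z.1 - s by ring,
      show z.1 - 2 * (z.1 - s) / 2 = s by ring, mul_comm (g _), ← mul_assoc, ← mul_assoc,
      ← mul_assoc, ← Complex.exp_add]
    congr 3
    push_cast
    ring
  have hc : Continuous fun z : ℝ × ℝ => (pureWigner g z : ℂ) := by
    simp_rw [hform]
    have : Continuous fun z : ℝ × ℝ => B (τ (2 * z.1), z.2) :=
      hB.comp ((hτ.comp (by fun_prop)).prodMk continuous_snd)
    fun_prop
  exact Complex.continuous_re.comp hc |>.congr fun z => Complex.ofReal_re _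
end

/-! ### The Wigner function of a density matrix -/

section
variable {ι : Type} (f : ι → L2R)

/-- The kernel `∑ᵢ fᵢ ⊗ conj fᵢ`. For `∑ᵢ ‖fᵢ‖² < ∞` the series converges absolutely at almost every
point; elsewhere it takes the junk value of `tsum`. -/
noncomputable def mixedKernel (p : ℝ × ℝ) : ℂ := ∑' i, rankOneKernel (f i) p

/-- The sum of the Wigner functions of the `fᵢ`. -/
noncomputable def mixedWigner (z : ℝ × ℝ) : ℝ := ∑' i, pureWigner (f i) z

variable {f}

theorem integral_normSq_coeFn (g : L2R) : ∫ y, ‖(g : ℝ → ℂ) y‖ ^ 2 = ‖g‖ ^ 2 := by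
  have h := L2.inner_def (𝕜 := ℂ) g g
  rw [inner_self_eq_norm_sq_to_K] at h
  have h2 : ∀ y, inner ℂ ((g : ℝ → ℂ) y) ((g : ℝ → ℂ) y) = ((‖(g : ℝ → ℂ) y‖ ^ 2 : ℝ) : ℂ) :=
    fun y => by rw [inner_self_eq_norm_sq_to_K]; simp
  simp_rw [h2] at h
  rw [integral_complex_ofReal] at h
  have h3 := Complex.ofReal_injective (h.symm.trans (Complex.ofReal_pow _ _).symm)
  exact h3

theorem Lp_coeFn_sum (s : Finset ι) (g : ι → L2R) :
    ((∑ i ∈ s, g i : L2R) : ℝ → ℂ) =ᵐ[volume] fun x => ∑ i ∈ s, (g i : ℝ → ℂ) x := by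
  classical
  induction s using Finset.induction_on with
  | empty => 
    simp only [Finset.sum_empty]
    exact Lp.coeFn_zero ℂ 2 volume
  | insert a s ha ih =>
    rw [Finset.sum_insert ha]
    filter_upwards [Lp.coeFn_add (g a) (∑ i ∈ s, g i), ih] with x hx hi
    rw [hx, Finset.sum_insert ha, Pi.add_apply, hi]

theorem integrable_tsum_normSq [Countable ι] (hs : Summable fun i => ‖f i‖ ^ 2) :
    Integrable fun u => ∑' i, ‖(f i : ℝ → ℂ) u‖ ^ 2 := by
  refine integrable_tsum_of_summable_integral_norm (fun i => integrable_normSq (Lp.memLp _)) ?_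
  simpa [integral_normSq_coeFn] using hs

theorem ae_summable_normSq [Countable ι] (hs : Summable fun i => ‖f i‖ ^ 2) :
    ∀ᵐ u, Summable fun i => ‖(f i : ℝ → ℂ) u‖ ^ 2 := by
  have := ae_summable_norm (fun i => integrable_normSq (Lp.memLp (f i)))
    (by simpa [integral_normSq_coeFn] using hs)
  simpa using this

/-- The Cauchy–Schwarz inequality for the series defining `mixedKernel`. -/
theorem norm_tsum_rankOneKernel_sq_le {f : ι → ℝ → ℂ} {u v : ℝ}
    (hu : Summable fun i => ‖f i u‖ ^ 2) (hv : Summable fun i => ‖f i v‖ ^ 2) :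
    ‖∑' i, rankOneKernel (f i) (u, v)‖ ^ 2 ≤ (∑' i, ‖f i u‖ ^ 2) * ∑' i, ‖f i v‖ ^ 2 := by
  have hsum : Summable fun i => rankOneKernel (f i) (u, v) :=
    ((hu.add hv).div_const 2).of_norm_bounded fun i => norm_rankOneKernel_le _ _ _
  refine le_of_tendsto' (hsum.hasSum.norm.pow 2) fun s => ?_
  calc ‖∑ i ∈ s, rankOneKernel (f i) (u, v)‖ ^ 2
      ≤ (∑ i ∈ s, ‖f i u‖ * ‖f i v‖) ^ 2 := by
        gcongr
        refine (norm_sum_le _ _).trans_eq (Finset.sum_congr rfl fun i _ => ?_)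
        rw [rankOneKernel, norm_mul, RCLike.norm_conj]
    _ ≤ (∑ i ∈ s, ‖f i u‖ ^ 2) * ∑ i ∈ s, ‖f i v‖ ^ 2 := Finset.sum_mul_sq_le_sq_mul_sq _ _ _
    _ ≤ _ := mul_le_mul (hu.sum_le_tsum s fun i _ => by positivity)
        (hv.sum_le_tsum s fun i _ => by positivity) (Finset.sum_nonneg fun i _ => by positivity)
        (tsum_nonneg fun i => by positivity)

theorem memLp_mixedKernel [Countable ι] (hs : Summable fun i => ‖f i‖ ^ 2) :
    MemLp (mixedKernel f) 2 (volume : Measure (ℝ × ℝ)) := by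
  have hmeas : AEStronglyMeasurable (mixedKernel f) (volume : Measure (ℝ × ℝ)) :=
    (AEMeasurable.tsum fun i => (stronglyMeasurable_rankOneKernel
      (Lp.stronglyMeasurable (f i))).measurable.aemeasurable).aestronglyMeasurable
  refine (memLp_two_iff_integrable_sq_norm hmeas).2 ?_
  refine ((integrable_tsum_normSq hs).mul_prod (integrable_tsum_normSq hs)).mono'
    (hmeas.norm.pow 2) ?_
  have h := ae_summable_normSq hs
  filter_upwards [Measure.quasiMeasurePreserving_fst.ae h,
    Measure.quasiMeasurePreserving_snd.ae h] with p h1 h2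
  rw [Real.norm_of_nonneg (by positivity)]
  exact norm_tsum_rankOneKernel_sq_le (f := fun i => (f i : ℝ → ℂ)) h1 h2

theorem isHilbertSchmidtKernel_mixedKernel [Countable ι] {ρ : L2R →L[ℂ] L2R}
    (hs : Summable fun i => ‖f i‖ ^ 2)
    (hf : ∀ ψ, HasSum (fun i => inner ℂ (f i) ψ • f i) (ρ ψ)) :
    IsHilbertSchmidtKernel ρ (mixedKernel f) := by
  refine ⟨memLp_mixedKernel hs, fun ψ => ?_⟩
  -- The partial sums converge in `L²`, hence almost everywhere along a sequence of index sets;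
  -- the pointwise limit along that sequence is the integral against the kernel.
  obtain ⟨ns, hns, hae⟩ := (tendstoInMeasure_of_tendsto_Lp (hf ψ)).exists_seq_tendsto_ae'
  have hcoe : ∀ᵐ x, ∀ n, ((∑ i ∈ ns n, inner ℂ (f i) ψ • f i : L2R) : ℝ → ℂ) x =
      ∑ i ∈ ns n, inner ℂ (f i) ψ * (f i : ℝ → ℂ) x := by
    refine ae_all_iff.2 fun n => ?_
    have h2 : ∀ᵐ x, ∀ i, ((inner ℂ (f i) ψ • f i : L2R) : ℝ → ℂ) x =
        inner ℂ (f i) ψ * (f i : ℝ → ℂ) x := ae_all_iff.2 fun i => Lp.coeFn_smul _ _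
    filter_upwards [Lp_coeFn_sum (ns n) fun i => inner ℂ (f i) ψ • f i, h2] with x hx hx2
    rw [hx]
    exact Finset.sum_congr rfl fun i _ => hx2 i
  filter_upwards [hae, hcoe, ae_summable_normSq hs] with x hx hc hsx
  let F : ι → ℝ → ℂ := fun i y => rankOneKernel (f i) (x, y) * (ψ : ℝ → ℂ) y
  have hFint : ∀ i, Integrable (F i) := fun i => by
    have : Integrable fun y => conj ((f i : ℝ → ℂ) y) * (ψ : ℝ → ℂ) y :=
      (Lp.memLp (f i)).star.integrable_mul (Lp.memLp ψ)
    refine (this.const_mul ((f i : ℝ → ℂ) x)).congr (ae_of_all _ fun y => ?_)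
    simp only [F, rankOneKernel, mul_assoc]
  have hFsum : Summable fun i => ∫ y, ‖F i y‖ := by
    refine Summable.of_nonneg_of_le (fun i => integral_nonneg fun y => norm_nonneg _) (fun i => ?_)
      (((hsx.mul_right (‖ψ‖ ^ 2)).add hs).div_const 2)
    rw [← integral_normSq_coeFn, ← integral_normSq_coeFn, ← integral_const_mul, ← integral_add
      ((integrable_normSq (Lp.memLp _)).const_mul _) (integrable_normSq (Lp.memLp _)),
      ← integral_div]
    refine integral_mono (hFint i).norm ((((integrable_normSq (Lp.memLp _)).const_mul _).add
      (integrable_normSq (Lp.memLp _))).div_const 2) fun y => ?_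
    simp only [F, rankOneKernel, norm_mul, RCLike.norm_conj]
    nlinarith [sq_nonneg (‖(f i : ℝ → ℂ) x‖ * ‖(ψ : ℝ → ℂ) y‖ - ‖(f i : ℝ → ℂ) y‖)]
  have hsum := hasSum_integral_of_summable_integral_norm hFint hFsum
  have e1 : ∀ i, ∫ y, F i y = inner ℂ (f i) ψ * (f i : ℝ → ℂ) x := fun i => by
    rw [L2.inner_def, ← integral_mul_const]
    refine integral_congr_ae (ae_of_all _ fun y => ?_)
    simp only [F, rankOneKernel, RCLike.inner_apply]
    ring
  have e2 : ∀ y, ∑' i, F i y = mixedKernel f (x, y) * (ψ : ℝ → ℂ) y := fun y => tsum_mul_right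
  simp_rw [e1, e2] at hsum
  simp_rw [hc] at hx
  exact tendsto_nhds_unique hx (hsum.comp hns)

theorem summable_integral_norm_wignerIntegrand (hs : Summable fun i => ‖f i‖ ^ 2) (z : ℝ × ℝ) :
    Summable fun i => ∫ y, ‖wignerIntegrand (rankOneKernel (f i)) z y‖ := by
  refine Summable.of_nonneg_of_le (fun i => integral_nonneg fun y => norm_nonneg _) (fun i => ?_)
      (hs.mul_left 2)
  rw [← integral_normSq_coeFn]
  exact integral_norm_wignerIntegrand_rankOne_le (Lp.stronglyMeasurable _) (Lp.memLp _) z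

theorem wignerIntegrand_mixedKernel (z : ℝ × ℝ) (y : ℝ) : wignerIntegrand (mixedKernel f) z y =
    ∑' i, wignerIntegrand (rankOneKernel (f i)) z y :=
  tsum_mul_left.symm

theorem integrable_wignerIntegrand_mixedKernel [Countable ι]
    (hs : Summable fun i => ‖f i‖ ^ 2) (z : ℝ × ℝ) :
    Integrable (wignerIntegrand (mixedKernel f) z) := by
  rw [funext (wignerIntegrand_mixedKernel z)]
  exact integrable_tsum_of_summable_integral_norm (fun i => integrable_wignerIntegrand_rankOne
    (Lp.stronglyMeasurable _) (Lp.memLp _) z) (summable_integral_norm_wignerIntegrand hs z)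

theorem ofReal_mixedWigner [Countable ι] (hs : Summable fun i => ‖f i‖ ^ 2) (z : ℝ × ℝ) :
    (mixedWigner f z : ℂ) =
      1 / (2 * (Real.pi : ℂ)) * ∫ y : ℝ, wignerIntegrand (mixedKernel f) z y := by
  rw [funext (wignerIntegrand_mixedKernel z), ← (hasSum_integral_of_summable_integral_norm
    (fun i => integrable_wignerIntegrand_rankOne
      (Lp.stronglyMeasurable _) (Lp.memLp _) z)
    (summable_integral_norm_wignerIntegrand hs z)).tsum_eq, ← tsum_mul_left, mixedWigner,
    Complex.ofReal_tsum]
  simp_rw [ofReal_pureWigner]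

theorem abs_pureWigner_coeFn_le (g : L2R) (z : ℝ × ℝ) : |pureWigner g z| ≤ ‖g‖ ^ 2 := by
  rw [← integral_normSq_coeFn]
  exact abs_pureWigner_le (Lp.stronglyMeasurable _) (Lp.memLp _) z

theorem continuous_mixedWigner (hs : Summable fun i => ‖f i‖ ^ 2) : Continuous (mixedWigner f) :=
  continuous_tsum (fun _ => continuous_pureWigner (Lp.memLp _)) hs
    fun _ z => abs_pureWigner_coeFn_le _ z

theorem isWignerFunction_mixedWigner [Countable ι] {ρ : L2R →L[ℂ] L2R}
    (hs : Summable fun i => ‖f i‖ ^ 2)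
    (hf : ∀ ψ, HasSum (fun i => inner ℂ (f i) ψ • f i) (ρ ψ)) :
    IsWignerFunction ρ (mixedWigner f) :=
  ⟨continuous_mixedWigner hs, mixedKernel f, isHilbertSchmidtKernel_mixedKernel hs hf,
    ae_of_all _ fun z => ⟨integrable_wignerIntegrand_mixedKernel hs z, ofReal_mixedWigner hs z⟩⟩
end

/-! ### Uniqueness of the kernel and of the Wigner function -/

theorem memLp_two_section {K : ℝ × ℝ → ℂ} (hK : MemLp K 2 (volume : Measure (ℝ × ℝ))) :
    ∀ᵐ x : ℝ, MemLp (fun y => K (x, y)) 2 := by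
  have h2 := ((memLp_two_iff_integrable_sq_norm hK.1).1 hK).prod_right_ae
  have h1 := AEStronglyMeasurable.prodMk_left (μ := (volume : Measure ℝ))
    (ν := (volume : Measure ℝ)) hK.1
  filter_upwards [h1, h2] with x hx1 hx2
  exact (memLp_two_iff_integrable_sq_norm hx1).2 hx2

/-- For almost every `x`, the sections `K(x, ·)` and `K'(x, ·)` are square-integrable and have the
same pairings with a countable dense subset of `L²(ℝ)`. -/
theorem IsHilbertSchmidtKernel.ae_eq {ρ : L2R →L[ℂ] L2R} {K K' : ℝ × ℝ → ℂ}
    (hK : IsHilbertSchmidtKernel ρ K) (hK' : IsHilbertSchmidtKernel ρ K') :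
    K =ᵐ[volume] K' := by
  have : Fact ((2 : ENNReal) ≠ ⊤) := ⟨by norm_num⟩
  have hψ : ∀ᵐ x : ℝ, ∀ n : ℕ,
      ∫ y : ℝ, K (x, y) * (TopologicalSpace.denseSeq L2R n : ℝ → ℂ) y =
      ∫ y : ℝ, K' (x, y) * (TopologicalSpace.denseSeq L2R n : ℝ → ℂ) y := by
    refine ae_all_iff.2 fun n => ?_
    filter_upwards [hK.apply_eq (TopologicalSpace.denseSeq L2R n),
      hK'.apply_eq (TopologicalSpace.denseSeq L2R n)] with x h1 h2
    rw [← h1, ← h2]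
  have hsec : ∀ᵐ x : ℝ, ∀ᵐ y : ℝ, K (x, y) = K' (x, y) := by
    filter_upwards [hψ, memLp_two_section hK.memLp, memLp_two_section hK'.memLp] with x hx h1 h2
    have hc1 : MemLp (fun y => conj (K (x, y))) 2 := h1.star
    have hc2 : MemLp (fun y => conj (K' (x, y))) 2 := h2.star
    have hin : ∀ {k : ℝ → ℂ} (hk : MemLp (fun y => conj (k y)) 2) (v : L2R),
        inner ℂ hk.toLp v = ∫ y, k y * (v : ℝ → ℂ) y := fun hk v => by
      rw [L2.inner_def]
      refine integral_congr_ae ?_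
      filter_upwards [hk.coeFn_toLp] with y hy
      rw [hy, RCLike.inner_apply, Complex.conj_conj, mul_comm]
    have h0 : hc1.toLp - hc2.toLp = 0 := by
      refine Dense.eq_zero_of_inner_left (𝕜 := ℂ)
        (TopologicalSpace.denseRange_denseSeq L2R) ?_
      rintro _ ⟨n, rfl⟩
      rw [inner_sub_left, hin, hin, hx n, sub_self]
    have h3 := (MemLp.toLp_eq_toLp_iff hc1 hc2).1 (sub_eq_zero.1 h0)
    filter_upwards [h3] with y hy
    exact (starRingEnd ℂ).injective hy
  have hint := (memLp_two_iff_integrable_sq_norm (hK.memLp.sub hK'.memLp).1).1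
    (hK.memLp.sub hK'.memLp)
  have hzero : ∫ p : ℝ × ℝ, ‖(K - K') p‖ ^ 2 = 0 := by
    refine (integral_prod _ hint).trans ?_
    refine integral_eq_zero_of_ae ?_
    filter_upwards [hsec] with x hx
    refine integral_eq_zero_of_ae ?_
    filter_upwards [hx] with y hy
    simp [hy]
  have := (integral_eq_zero_iff_of_nonneg (fun p => by positivity) hint).1 hzero
  filter_upwards [this] with p hp
  simpa [sub_eq_zero] using hp

theorem IsWignerFunction.unique {ρ : L2R →L[ℂ] L2R} {W W' : ℝ × ℝ → ℝ}
    (hW : IsWignerFunction ρ W) (hW' : IsWignerFunction ρ W') : W = W' := by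
  obtain ⟨K, hK, h⟩ := hW.exists_kernel
  obtain ⟨K', hK', h'⟩ := hW'.exists_kernel
  have hKK := measurePreserving_wignerMap.quasiMeasurePreserving.ae (hK.ae_eq hK')
  have hsec : ∀ᵐ x : ℝ, ∀ᵐ y : ℝ, K (x + y / 2, x - y / 2) = K' (x + y / 2, x - y / 2) :=
    Measure.ae_ae_of_ae_prod hKK
  have hsec' := Measure.quasiMeasurePreserving_fst (μ := (volume : Measure ℝ))
    (ν := (volume : Measure ℝ)).ae hsec
  refine (Continuous.ae_eq_iff_eq volume hW.continuous hW'.continuous).1 ?_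
  filter_upwards [h, h', hsec'] with z hz hz' hs
  have : (W z : ℂ) = W' z := by
    rw [hz.2, hz'.2]
    congr 1
    refine integral_congr_ae ?_
    filter_upwards [hs] with y hy
    simp only [wignerIntegrand, hy]
  exact_mod_cast this

/-! ### Positivity of Gaussian averages of the Wigner function -/

/-- The weight `exp(-x² - ξ² + 2 a x)` at `z = (x, ξ)`. Up to a constant factor it is the Wigner
function of the Gaussian `exp(-x² / 2 + a x)`. -/
noncomputable def gaussianWeight (a : ℝ) (z : ℝ × ℝ) : ℝ :=
  Real.exp (-z.1 ^ 2 + 2 * a * z.1) * Real.exp (-z.2 ^ 2)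

theorem integrable_exp_neg_sq_add (a : ℝ) :
    Integrable fun x : ℝ => Real.exp (-x ^ 2 + 2 * a * x) := by
  have h := ((integrable_exp_neg_mul_sq one_pos).comp_sub_right a).const_mul (Real.exp (a ^ 2))
  refine h.congr (ae_of_all _ fun x => ?_)
  dsimp only
  rw [← Real.exp_add]
  congr 1
  ring

theorem integrable_exp_neg_sq : Integrable fun x : ℝ => Real.exp (-x ^ 2) := by
  simpa using integrable_exp_neg_sq_add 0

theorem integrable_gaussianWeight (a : ℝ) : Integrable (gaussianWeight a) :=
  (integrable_exp_neg_sq_add a).mul_prod integrable_exp_neg_sq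

theorem continuous_gaussianWeight (a : ℝ) : Continuous (gaussianWeight a) := by
  unfold gaussianWeight; fun_prop

theorem memLp_exp_neg_sq_div_two (a : ℝ) :
    MemLp (fun x : ℝ => (Real.exp (-x ^ 2 / 2 + a * x) : ℂ)) 2 := by
  refine (memLp_two_iff_integrable_sq_norm
    (by fun_prop : Continuous _).aestronglyMeasurable).2 ?_
  refine (integrable_exp_neg_sq_add a).congr (ae_of_all _ fun x => ?_)
  dsimp only
  rw [Complex.norm_real, Real.norm_eq_abs, sq_abs, ← Real.exp_nat_mul]
  congr 1
  push_cast
  ring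

section
variable {g : ℝ → ℂ}

/-- Integrating out `ξ` against a Gaussian turns the oscillating factor into a Gaussian in `y`. -/
theorem integral_pureWigner_mul_exp_neg_sq (hgm : StronglyMeasurable g) (hg : MemLp g 2) (x : ℝ) :
    ∫ ξ : ℝ, (pureWigner g (x, ξ) : ℂ) * (Real.exp (-ξ ^ 2) : ℂ) =
      ((1 / (2 * Real.pi) * Real.pi ^ (1 / 2 : ℝ) : ℝ) : ℂ) *
        ∫ y : ℝ, rankOneKernel g (x + y / 2, x - y / 2) * (Real.exp (-y ^ 2 / 4) : ℂ) := by
  set h : ℝ → ℂ := wignerIntegrand (rankOneKernel g) (x, 0) with hh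
  have h_eq : ∀ ξ y, wignerIntegrand (rankOneKernel g) (x, ξ) y =
      Complex.exp (-(Complex.I * ξ * y)) * h y := fun ξ y => by simp [hh, wignerIntegrand]
  have h_int : Integrable h := integrable_wignerIntegrand_rankOne hgm hg _
  have hF : Integrable (Function.uncurry fun ξ y : ℝ => Complex.exp (-(Complex.I * ξ * y)) *
      ((Real.exp (-ξ ^ 2) : ℂ) * h y)) (volume.prod volume) := by
    have h1 : Integrable (fun p : ℝ × ℝ => (Real.exp (-p.1 ^ 2) : ℂ) * h p.2)
        (volume.prod volume) := integrable_exp_neg_sq.ofReal.mul_prod h_int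
    refine h1.norm.mono' ?_ (ae_of_all _ fun p => ?_)
    · exact (by fun_prop : Continuous fun p : ℝ × ℝ =>
        Complex.exp (-(Complex.I * p.1 * p.2))).aestronglyMeasurable.mul h1.1
    · simp only [Function.uncurry]
      rw [norm_mul, show -(Complex.I * (p.1 : ℂ) * p.2) = ((-(p.1 * p.2) : ℝ) : ℂ) * Complex.I by
        push_cast; ring, Complex.norm_exp_ofReal_mul_I, one_mul]
  have hgauss : ∀ y : ℝ, ∫ ξ : ℝ, Complex.exp (-(Complex.I * ξ * y)) *
      ((Real.exp (-ξ ^ 2) : ℂ) * h y) =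
      ((Real.pi ^ (1 / 2 : ℝ) : ℝ) : ℂ) * ((Real.exp (-y ^ 2 / 4) : ℂ) * h y) := fun y => by
    have := fourierIntegral_gaussian (b := 1) (by simp) (-y : ℂ)
    simp_rw [← mul_assoc]
    rw [integral_mul_const]
    congr 1
    convert this using 1
    · refine integral_congr_ae (ae_of_all _ fun ξ => ?_)
      dsimp only
      push_cast
      congr 2 <;> ring
    · rw [Complex.ofReal_cpow Real.pi_pos.le]
      push_cast
      simp
  calc ∫ ξ : ℝ, (pureWigner g (x, ξ) : ℂ) * (Real.exp (-ξ ^ 2) : ℂ)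
      = ∫ ξ : ℝ, 1 / (2 * (Real.pi : ℂ)) * ∫ y : ℝ, Complex.exp (-(Complex.I * ξ * y)) *
          ((Real.exp (-ξ ^ 2) : ℂ) * h y) := by
        refine integral_congr_ae (ae_of_all _ fun ξ => ?_)
        dsimp only
        rw [ofReal_pureWigner, mul_assoc, ← integral_mul_const]
        congr 2
        ext y
        rw [h_eq]
        ring
    _ = 1 / (2 * (Real.pi : ℂ)) * ∫ y : ℝ, ∫ ξ : ℝ, Complex.exp (-(Complex.I * ξ * y)) *
          ((Real.exp (-ξ ^ 2) : ℂ) * h y) := by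
        rw [integral_const_mul, integral_integral_swap hF]
    _ = _ := by
        simp_rw [hgauss]
        rw [integral_const_mul, ← mul_assoc]
        push_cast
        congr 1
        refine integral_congr_ae (ae_of_all _ fun y => ?_)
        simp [hh, wignerIntegrand, mul_comm]

theorem integrable_mul_gaussianWeight {W : ℝ × ℝ → ℝ} (hW : Continuous W) {C : ℝ}
    (hC : ∀ z, |W z| ≤ C) (a : ℝ) : Integrable fun z => W z * gaussianWeight a z :=
  (integrable_gaussianWeight a).bdd_mul hW.aestronglyMeasurable (ae_of_all _ hC)

/-- The integral is a positive multiple of `|∫ g(x) exp(-x² / 2 + a x) dx|²`. -/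
theorem integral_pureWigner_mul_gaussianWeight_nonneg (hgm : StronglyMeasurable g)
    (hg : MemLp g 2) (a : ℝ) : 0 ≤ ∫ z, pureWigner g z * gaussianWeight a z := by
  set c : ℝ := 1 / (2 * Real.pi) * Real.pi ^ (1 / 2 : ℝ) with hcdef
  let k : ℝ → ℂ := fun x => g x * (Real.exp (-x ^ 2 / 2 + a * x) : ℂ)
  have hk : Integrable k := hg.integrable_mul (memLp_exp_neg_sq_div_two a)
  have hkk : Integrable (rankOneKernel k) (volume.prod volume) :=
    hk.mul_prod (Complex.conjCLE.integrable_comp_iff.2 hk)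
  have hkernel : ∀ x y : ℝ, (Real.exp (-x ^ 2 + 2 * a * x) : ℂ) *
      (rankOneKernel g (x + y / 2, x - y / 2) * (Real.exp (-y ^ 2 / 4) : ℂ)) =
      rankOneKernel k (x + y / 2, x - y / 2) := fun x y => by
    simp only [rankOneKernel, k, map_mul, Complex.conj_ofReal]
    have : Real.exp (-x ^ 2 + 2 * a * x) * Real.exp (-y ^ 2 / 4) =
        Real.exp (-(x + y / 2) ^ 2 / 2 + a * (x + y / 2)) *
        Real.exp (-(x - y / 2) ^ 2 / 2 + a * (x - y / 2)) := by
      rw [← Real.exp_add, ← Real.exp_add]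
      congr 1
      ring
    have h2 : (Real.exp (-x ^ 2 + 2 * a * x) : ℂ) * (Real.exp (-y ^ 2 / 4) : ℂ) =
        (Real.exp (-(x + y / 2) ^ 2 / 2 + a * (x + y / 2)) : ℂ) *
        (Real.exp (-(x - y / 2) ^ 2 / 2 + a * (x - y / 2)) : ℂ) := by exact_mod_cast this
    linear_combination (g (x + y / 2) * conj (g (x - y / 2))) * h2
  have hint : Integrable (fun z => ((pureWigner g z * gaussianWeight a z : ℝ) : ℂ))
      (volume.prod volume) :=
    (integrable_mul_gaussianWeight (continuous_pureWigner hg) (abs_pureWigner_le hgm hg) a).ofReal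
  have hmain : ((∫ z, pureWigner g z * gaussianWeight a z : ℝ) : ℂ) =
      ((c * ‖∫ x, k x‖ ^ 2 : ℝ) : ℂ) := by
    rw [← integral_complex_ofReal]
    calc ∫ z, ((pureWigner g z * gaussianWeight a z : ℝ) : ℂ)
        = ∫ x : ℝ, ∫ ξ : ℝ, ((pureWigner g (x, ξ) * gaussianWeight a (x, ξ) : ℝ) : ℂ) :=
          integral_prod _ hint
      _ = ∫ x : ℝ, (c : ℂ) * ∫ y : ℝ, rankOneKernel k (x + y / 2, x - y / 2) := by
          refine integral_congr_ae (ae_of_all _ fun x => ?_)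
          dsimp only
          simp_rw [← hkernel]
          rw [integral_const_mul, mul_left_comm, ← integral_pureWigner_mul_exp_neg_sq hgm hg,
            ← integral_const_mul]
          congr 1
          ext ξ
          simp only [gaussianWeight]
          push_cast
          ring
      _ = (c : ℂ) * ∫ p : ℝ × ℝ, rankOneKernel k (p.1 + p.2 / 2, p.1 - p.2 / 2) := by
          rw [integral_const_mul]
          congr 1
          exact (integral_prod _ (measurePreserving_wignerMap.integrable_comp_of_integrable
            hkk)).symm
      _ = (c : ℂ) * ∫ p : ℝ × ℝ, rankOneKernel k p := by
          congr 1
          conv_rhs => rw [← measurePreserving_wignerMap.map_eq]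
          refine (integral_map measurePreserving_wignerMap.measurable.aemeasurable ?_).symm
          rw [measurePreserving_wignerMap.map_eq]
          exact hkk.1
      _ = _ := by
          have : ∫ p : ℝ × ℝ, rankOneKernel k p = (∫ x, k x) * ∫ x, conj (k x) :=
            integral_prod_mul k fun x => conj (k x)
          rw [this, integral_conj, RCLike.mul_conj]
          push_cast
          rfl
  rw [Complex.ofReal_injective hmain]
  positivity
end

theorem integral_mixedWigner_mul_gaussianWeight_nonneg {ι : Type} [Countable ι] {f : ι → L2R}
    (hs : Summable fun i => ‖f i‖ ^ 2) (a : ℝ) :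
    0 ≤ ∫ z, mixedWigner f z * gaussianWeight a z := by
  have hint : ∀ i, Integrable fun z => pureWigner (f i) z * gaussianWeight a z := fun i =>
    integrable_mul_gaussianWeight (continuous_pureWigner (Lp.memLp _))
      (abs_pureWigner_coeFn_le (f i)) a
  have hG : ∀ z, 0 ≤ gaussianWeight a z := fun z => by unfold gaussianWeight; positivity
  have hsum : Summable fun i => ∫ z, ‖pureWigner (f i) z * gaussianWeight a z‖ := by
    refine Summable.of_nonneg_of_le (fun i => integral_nonneg fun y => norm_nonneg _) (fun i => ?_)
      (hs.mul_right (∫ z, gaussianWeight a z))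
    rw [← integral_const_mul]
    refine integral_mono (hint i).norm ((integrable_gaussianWeight a).const_mul _) fun z => ?_
    dsimp only
    rw [norm_mul, Real.norm_of_nonneg (hG z)]
    exact mul_le_mul_of_nonneg_right (abs_pureWigner_coeFn_le (f i) z) (hG z)
  have h := hasSum_integral_of_summable_integral_norm hint hsum
  simp_rw [tsum_mul_right] at h
  exact h.nonneg fun i => integral_pureWigner_mul_gaussianWeight_nonneg
    (Lp.stronglyMeasurable _) (Lp.memLp _) a

theorem abs_mixedWigner_le {ι : Type} {f : ι → L2R} (hs : Summable fun i => ‖f i‖ ^ 2)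
    (z : ℝ × ℝ) : |mixedWigner f z| ≤ ∑' i, ‖f i‖ ^ 2 := by
  rw [mixedWigner, ← Real.norm_eq_abs]
  exact tsum_of_norm_bounded hs.hasSum fun i => abs_pureWigner_coeFn_le (f i) z

/-! ### The sign of the Wigner function near infinity -/

theorem isPreconnected_setOf_lt_norm {E : Type*} [NormedAddCommGroup E] [NormedSpace ℝ E]
    (h : 1 < Module.rank ℝ E) {R : ℝ} (hR : 0 ≤ R) : IsPreconnected {z : E | R < ‖z‖} := by
  have h1 : {z : E | R < ‖z‖} =
      (fun q : E × ℝ => q.2 • q.1) '' (Metric.sphere (0 : E) 1 ×ˢ Set.Ioi R) := by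
    ext z
    constructor
    · intro hz
      have hz0 : 0 < ‖z‖ := hR.trans_lt hz
      refine ⟨(‖z‖⁻¹ • z, ‖z‖), ⟨?_, hz⟩, ?_⟩
      · simp [norm_smul, hz0.ne']
      · simp [smul_smul, hz0.ne']
    · rintro ⟨⟨p, r⟩, ⟨hp, hr⟩, rfl⟩
      simp only [mem_sphere_iff_norm, sub_zero, Set.mem_Ioi] at hp hr
      simpa [norm_smul, hp, abs_of_pos (hR.trans_lt hr)] using hr
  rw [h1]
  exact ((isPreconnected_sphere h 0 1).prod isPreconnected_Ioi).image _ (by fun_prop)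

/-- A continuous function with nonnegative integrals against all `gaussianWeight a` cannot be
negative everywhere outside a ball: as `a → ∞` the weight concentrates on ever larger `x`. -/
theorem not_forall_neg_of_gaussianWeight {W : ℝ × ℝ → ℝ} (hW : Continuous W)
    (hint : ∀ a, Integrable fun z => W z * gaussianWeight a z)
    (hpos : ∀ a, 0 ≤ ∫ z, W z * gaussianWeight a z) {R : ℝ} (hR : 0 ≤ R) :
    ¬ ∀ z, R < ‖z‖ → W z < 0 := by
  intro hneg
  let S : Set (ℝ × ℝ) := Metric.closedBall 0 R
  let T : Set (ℝ × ℝ) := Set.Icc (R + 1) (R + 2) ×ˢ Set.Icc 0 1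
  have hTc : IsCompact T := isCompact_Icc.prod isCompact_Icc
  have hSc : IsCompact S := isCompact_closedBall 0 R
  have hTn : ∀ z ∈ T, R < ‖z‖ := fun z hz => by
    have h1 : ‖z.1‖ ≤ ‖z‖ := norm_fst_le z
    have h2 : z.1 ≤ ‖z.1‖ := Real.le_norm_self _
    have := hz.1.1
    linarith
  obtain ⟨M, hM⟩ := hSc.exists_bound_of_continuousOn hW.continuousOn
  have hM0 : 0 ≤ M := (norm_nonneg _).trans (hM 0 (by simp [S, hR]))
  obtain ⟨t, htT, ht⟩ := hTc.exists_isMaxOn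
    ⟨(R + 1, 0), by simp [T]⟩ (hW.mul (continuous_gaussianWeight 0)).continuousOn
  have hG0 : ∀ z, 0 < gaussianWeight 0 z := fun z => by unfold gaussianWeight; positivity
  set c : ℝ := -(W t * gaussianWeight 0 t) with hc
  have hc0 : 0 < c := by
    have := mul_neg_of_neg_of_pos (hneg t (hTn t htT)) (hG0 t)
    linarith
  have hcT : ∀ z ∈ T, W z * gaussianWeight 0 z ≤ -c := fun z hz => by
    rw [hc, neg_neg]; exact ht hz
  have hG0le : ∀ z, gaussianWeight 0 z ≤ 1 := fun z => by
    unfold gaussianWeight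
    rw [← Real.exp_add]
    exact Real.exp_le_one_iff.2 (by nlinarith [sq_nonneg z.1, sq_nonneg z.2])
  have hVT : 0 < volume.real T := by
    refine ENNReal.toReal_pos ?_ hTc.measure_lt_top.ne
    rw [Measure.volume_eq_prod, Measure.prod_prod]
    simp
  have key : ∀ a, 0 ≤ a → Real.exp (2 * a) * (c * volume.real T) ≤ M * volume.real S := by
    intro a ha
    have hfac : ∀ z, W z * gaussianWeight a z * Real.exp (-(2 * a * R)) =
        W z * gaussianWeight 0 z * Real.exp (2 * a * (z.1 - R)) := fun z => by
      simp only [gaussianWeight, mul_assoc, ← Real.exp_add]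
      congr 2
      ring
    -- After rescaling by `exp(-2 a R)` the integrand is at most `M` on the ball (where `z.1 ≤ R`),
    -- at most `-exp(2 a) c` on `T` (where `R + 1 ≤ z.1`), and negative elsewhere.
    have hpt : ∀ z, W z * gaussianWeight a z * Real.exp (-(2 * a * R)) ≤
        S.indicator (fun _ => M) z - T.indicator (fun _ => Real.exp (2 * a) * c) z := by
      intro z
      rw [hfac]
      by_cases hzS : z ∈ S
      · have hzT : z ∉ T := fun hz => by
          have := hTn z hz
          simp [S] at hzS
          linarith
        rw [Set.indicator_of_mem hzS, Set.indicator_of_notMem hzT, sub_zero]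
        have hx : z.1 ≤ R := by
          have h1 : ‖z.1‖ ≤ ‖z‖ := norm_fst_le z
          have h2 : z.1 ≤ ‖z.1‖ := Real.le_norm_self _
          simp [S] at hzS
          linarith
        have he : Real.exp (2 * a * (z.1 - R)) ≤ 1 :=
          Real.exp_le_one_iff.2 (mul_nonpos_of_nonneg_of_nonpos (by linarith) (by linarith))
        have hWM : W z ≤ M := (Real.le_norm_self _).trans (hM z hzS)
        calc W z * gaussianWeight 0 z * Real.exp (2 * a * (z.1 - R))
            ≤ M * gaussianWeight 0 z * Real.exp (2 * a * (z.1 - R)) := by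
              have := (hG0 z).le
              gcongr
          _ ≤ M * 1 * 1 := by
              have := hG0le z
              have := (hG0 z).le
              gcongr
          _ = M := by ring
      · rw [Set.indicator_of_notMem hzS, zero_sub]
        have hWz : W z < 0 := hneg z (by simpa [S] using hzS)
        by_cases hzT : z ∈ T
        · rw [Set.indicator_of_mem hzT]
          have h1 : Real.exp (2 * a) ≤ Real.exp (2 * a * (z.1 - R)) :=
            Real.exp_le_exp.2 (by nlinarith [hzT.1.1])
          have h2 := hcT z hzT
          nlinarith [Real.exp_pos (2 * a)]
        · rw [Set.indicator_of_notMem hzT, neg_zero]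
          exact mul_nonpos_of_nonpos_of_nonneg (mul_nonpos_of_nonpos_of_nonneg hWz.le (hG0 z).le)
            (Real.exp_pos _).le
    have hSi : Integrable (S.indicator fun _ => M) :=
      (integrable_indicator_iff hSc.measurableSet).2 (integrableOn_const hSc.measure_lt_top.ne)
    have hTi : Integrable (T.indicator fun _ => Real.exp (2 * a) * c) :=
      (integrable_indicator_iff hTc.measurableSet).2 (integrableOn_const hTc.measure_lt_top.ne)
    have h := integral_mono ((hint a).mul_const (Real.exp (-(2 * a * R)))) (hSi.sub hTi) hpt
    rw [integral_mul_const, integral_sub' hSi hTi, integral_indicator hSc.measurableSet,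
      integral_indicator hTc.measurableSet, setIntegral_const, setIntegral_const, smul_eq_mul,
      smul_eq_mul] at h
    have := mul_nonneg (hpos a) (Real.exp_pos (-(2 * a * R))).le
    linarith
  have hcT0 : 0 < c * volume.real T := mul_pos hc0 hVT
  have hMS : 0 ≤ M * volume.real S := mul_nonneg hM0 measureReal_nonneg
  -- For this `a`, the bound `exp(2 a) ≥ 1 + 2 a` already contradicts `key`.
  have h1 := key (M * volume.real S / (c * volume.real T)) (by positivity)
  have h2 := Real.add_one_le_exp (2 * (M * volume.real S / (c * volume.real T)))
  have h3 := (mul_le_mul_of_nonneg_right h2 hcT0.le).trans h1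
  have h4 : M * volume.real S / (c * volume.real T) * (c * volume.real T) = M * volume.real S :=
    div_mul_cancel₀ _ hcT0.ne'
  nlinarith

theorem mainTheorem12 (ρ : L2R →L[ℂ] L2R) (hρ : IsDensityMatrix ρ) :
    (∃! W : ℝ × ℝ → ℝ, IsWignerFunction ρ W) ∧
    ∀ W : ℝ × ℝ → ℝ, IsWignerFunction ρ W → Bornology.IsBounded (nodalSet W) →
      Bornology.IsBounded (negativeSet W) ∧ IsClosed (negativeSet W) ∧
        IsCompact (negativeSet W) := by
  obtain ⟨ι, _, f, hs, hf⟩ := hρ.exists_hasSum_rankOne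
  have hWf := isWignerFunction_mixedWigner hs hf
  refine ⟨⟨mixedWigner f, hWf, fun W hW => hW.unique hWf⟩, fun W hW hnodal => ?_⟩
  obtain rfl : W = mixedWigner f := hW.unique hWf
  have hclosed : IsClosed (negativeSet (mixedWigner f)) :=
    isClosed_le hW.continuous continuous_const
  suffices hb : Bornology.IsBounded (negativeSet (mixedWigner f)) from
    ⟨hb, hclosed, Metric.isCompact_of_isClosed_isBounded hclosed hb⟩
  obtain ⟨R, hR0, hR⟩ := hnodal.exists_pos_norm_le
  refine (Metric.isBounded_closedBall (x := (0 : ℝ × ℝ)) (r := R)).subset fun z hz => ?_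
  by_contra hzR
  have hzR : R < ‖z‖ := by simpa using hzR
  refine not_forall_neg_of_gaussianWeight hW.continuous
    (integrable_mul_gaussianWeight hW.continuous (abs_mixedWigner_le hs))
    (integral_mixedWigner_mul_gaussianWeight_nonneg hs) hR0.le fun w hw => ?_
  by_contra! hw0
  have hrank : 1 < Module.rank ℝ (ℝ × ℝ) := by
    simp [one_add_one_eq_two]
  obtain ⟨v, hv, hv0⟩ := (isPreconnected_setOf_lt_norm hrank hR0.le).intermediate_value
    hzR hw hW.continuous.continuousOn ⟨hz, hw0⟩
  exact absurd (hR v hv0) (not_le.2 hv)
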